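/- Let $(X_1,\|\cdot\|_1)$ and $(X_2,\|\cdot\|_2)$ be reflexive real Banach spaces with $X_2\subset X_1$ densely and continuously, and let $C_N\ge 1$ satisfy $\|v\|_1\le C_N\|v\|_2$ for all $v\in X_2$; accordingly $X_1^*\subset X_2^*$ by restriction. For a functional $F$ on a Banach space $X$ with values in $[0,\infty]$ let $F^*(\xi)=\sup_{v\in X}\big(\langle\xi,v\rangle-F(v)\big)$, $\xi\in X^*$, be its convex conjugate. For $j=1,2$ let $R_j:X_j\to[0,\infty)$ be convex and lower semicontinuous with $R_j(0)=0$, and let $R_j$ and $R_j^*$ be superlinear, i.e. $R_j(v)/\|v\|_j\to\infty$ as $\|v\|_j\to\infty$ and $R_j^*(\xi)/\|\xi\|_{X_j^*}\to\infty$ as $\|\xi\|_{X_j^*}\to\infty$. Let $\overline R_2:X_1\to[0,\infty]$ be equal to $R_2$ on $X_2$ and to $\infty$ on $X_1\setminus X_2$, and define $$R_{\mathrm{eff}}(v)=\inf\{R_1(v_1)+\overline R_2(v_2): v_1,v_2\in X_1,\ v_1+v_2=v\},\qquad v\in X_1.$$ Then: (0) $R_{\mathrm{eff}}$ takes values in $[0,\infty)$,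 and for every $v\in X_1$ the infimum is attained. (1) $R_{\mathrm{eff}}$ is convex and lower semicontinuous on $X_1$, and its conjugate is finite and given by $R_{\mathrm{eff}}^*(\xi)=R_1^*(\xi)+R_2^*(\xi|_{X_2})\in[0,\infty)$ for all $\xi\in X_1^*$. (2) There exists a convex, nondecreasing function $\Psi:[0,\infty)\to[0,\infty)$ with $\Psi(r)/r\to\infty$ as $r\to\infty$ such that, for $j=1,2$, $R_j(v)\ge\Psi(\|v\|_j)$ for all $v\in X_j$ and $R_j^*(\xi)\ge\Psi(\|\xi\|_{X_j^*})$ for all $\xi\in X_j^*$. For every such $\Psi$, with $\Psi^*(s)=\sup_{r\ge0}(rs-\Psi(r))$, $$2\Psi\Big(\frac{1}{2C_N}\|v\|_1\Big)\le R_{\mathrm{eff}}(v)\le R_1(v)\le\Psi^*(\|v\|_1)\qquad\text{for all }v\in X_1.$$ -/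

import Mathlib

open Filter Topology

noncomputable section

namespace InfConvolution

/-- A real normed space is reflexive if the canonical embedding into its bidual is onto. -/
def IsReflexive (X : Type*) [NormedAddCommGroup X] [NormedSpace ℝ X] : Prop :=
  Function.Surjective (NormedSpace.inclusionInDoubleDual ℝ X)

/-- The convex (Legendre-Fenchel) conjugate `F*(ξ) = sup_v (⟨ξ, v⟩ - F v)` on the topological dual.
It is only applied to functionals with values in `[0, ∞]`, so `∞ - ∞` never occurs. -/
def conjugate {X : Type*} [NormedAddCommGroup X] [NormedSpace ℝ X] (F : X → EReal)
    (ξ : StrongDual ℝ X) : EReal :=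
  ⨆ v : X, ((ξ v : ℝ) : EReal) - F v

/-- Superlinear dissipation potentials: `R : X → [0, ∞)` is convex, lower semicontinuous,
`R 0 = 0`, and `R` and `R*` grow superlinearly. (Finiteness of `R*` is a consequence of the
superlinear growth of `R`.) -/
structure IsDissipationPotential {X : Type*} [NormedAddCommGroup X] [NormedSpace ℝ X]
    (R : X → ℝ) : Prop where
  nonneg : ∀ v, 0 ≤ R v
  zero : R 0 = 0
  convex : ConvexOn ℝ Set.univ R
  lsc : LowerSemicontinuous R
  superlinear : Tendsto (fun v => R v / ‖v‖) (Bornology.cobounded X) atTop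
  conjugate_superlinear :
    Tendsto (fun ξ : StrongDual ℝ X => conjugate (fun v => (R v : EReal)) ξ / ((‖ξ‖ : ℝ) : EReal))
      (Bornology.cobounded (StrongDual ℝ X)) (𝓝 ⊤)

/-- `Ψ : [0, ∞) → [0, ∞)` (only the values of `Ψ` on `[0, ∞)` matter) is convex, nondecreasing and
superlinear, and `Ψ ∘ ‖·‖` bounds both `R` and `R*` from below, for `R = R₁` and `R = R₂`. -/
structure IsSuperlinearMinorant {X₁ X₂ : Type*} [NormedAddCommGroup X₁] [NormedSpace ℝ X₁]
    [NormedAddCommGroup X₂] [NormedSpace ℝ X₂] (R₁ : X₁ → ℝ) (R₂ : X₂ → ℝ) (Ψ : ℝ → ℝ) : Prop where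
  nonneg : ∀ r, 0 ≤ r → 0 ≤ Ψ r
  convex : ConvexOn ℝ (Set.Ici 0) Ψ
  mono : MonotoneOn Ψ (Set.Ici 0)
  superlinear : Tendsto (fun r => Ψ r / r) atTop atTop
  le₁ : ∀ v, Ψ ‖v‖ ≤ R₁ v
  le₂ : ∀ v, Ψ ‖v‖ ≤ R₂ v
  le_conjugate₁ : ∀ ξ : StrongDual ℝ X₁, (Ψ ‖ξ‖ : EReal) ≤ conjugate (fun v => (R₁ v : EReal)) ξ
  le_conjugate₂ : ∀ ξ : StrongDual ℝ X₂, (Ψ ‖ξ‖ : EReal) ≤ conjugate (fun v => (R₂ v : EReal)) ξ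

/-- The conjugate `Ψ*(s) = sup_{r ≥ 0} (r s - Ψ r)` of a function on `[0, ∞)`. -/
def halfLineConjugate (Ψ : ℝ → ℝ) (s : ℝ) : EReal :=
  ⨆ r : Set.Ici (0 : ℝ), (((r : ℝ) * s - Ψ r : ℝ) : EReal)

/-- The extension of `R₂ : X₂ → ℝ` to `X₁` by `∞` outside the image of the embedding
`ι : X₂ → X₁`. -/
def extendByTop {X₁ X₂ : Type*} (ι : X₂ → X₁) (R₂ : X₂ → ℝ) : X₁ → EReal :=
  Function.extend ι (fun w => (R₂ w : EReal)) (fun _ => ⊤)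

/-- The infimal convolution of two `[0, ∞]`-valued functionals. -/
def infConv {X : Type*} [Add X] (F G : X → EReal) (v : X) : EReal :=
  ⨅ (p : X × X) (_ : p.1 + p.2 = v), F p.1 + G p.2

/-- The effective dissipation potential `v ↦ inf_{v₁ + v₂ = v} R₁ v₁ + R̄₂ v₂` on `X₁`, where `R̄₂`
extends `R₂` by `∞`. -/
def effectivePotential {X₁ X₂ : Type*} [Add X₁] (ι : X₂ → X₁) (R₁ : X₁ → ℝ) (R₂ : X₂ → ℝ) :
    X₁ → EReal :=
  infConv (fun v => (R₁ v : EReal)) (extendByTop ι R₂)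

end InfConvolution

end

/-!
Writing the effective potential as the partial infimum `v ↦ inf_w R₁ (v - ι w) + R₂ w` of a jointly
convex function makes it convex. For fixed `v` the function of `w` is convex, lower semicontinuous
and coercive, and bounded closed convex sets of the reflexive space `X₂` are weakly compact, so the
infimum is attained. By Fenchel–Moreau, the superlinear growth of `R₁*` bounds `R₁` near `0`; hence
`R₁` is continuous, and so is the smaller convex function `R_eff`. The minorant `Ψ` is a supremum of
affine functions, one for each integer slope, and the lower bound on `R_eff` is midpoint convexity
of `Ψ` along `v = (v - ι w) + ι w`.
-/

namespace InfConvolution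

section ConvexFunctions

theorem convexOn_ciSup {E ι : Type*} [AddCommGroup E] [Module ℝ E] [Nonempty ι] {s : Set E}
    {f : ι → E → ℝ} (hs : Convex ℝ s) (hf : ∀ i, ConvexOn ℝ s (f i))
    (hbdd : ∀ x ∈ s, BddAbove (Set.range fun i => f i x)) :
    ConvexOn ℝ s fun x => ⨆ i, f i x := by
  refine ⟨hs, fun x hx y hy a b ha hb hab => ciSup_le fun i => ?_⟩
  calc f i (a • x + b • y) ≤ a • f i x + b • f i y := (hf i).2 hx hy ha hb hab
    _ ≤ a • (⨆ i, f i x) + b • ⨆ i, f i y := by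
      gcongr
      exacts [le_ciSup (hbdd x hx) i, le_ciSup (hbdd y hy) i]

theorem convexOn_ciInf_snd {E F : Type*} [AddCommGroup E] [Module ℝ E] [AddCommGroup F]
    [Module ℝ F] {φ : E × F → ℝ} (hφ : ConvexOn ℝ Set.univ φ)
    (hbdd : ∀ x, BddBelow (Set.range fun y => φ (x, y))) :
    ConvexOn ℝ Set.univ fun x => ⨅ y, φ (x, y) := by
  refine ⟨convex_univ, fun x _ x' _ a b ha hb hab => ?_⟩
  simp only [smul_eq_mul, Real.mul_iInf_of_nonneg ha, Real.mul_iInf_of_nonneg hb]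
  exact le_ciInf_add_ciInf fun y y' => (ciInf_le (hbdd _) (a • y + b • y')).trans
    (hφ.2 (Set.mem_univ (x, y)) (Set.mem_univ (x', y')) ha hb hab)

variable {X : Type*} [NormedAddCommGroup X] [NormedSpace ℝ X] {f : X → ℝ}

theorem continuous_of_convexOn_of_eventually_le (hf : ConvexOn ℝ Set.univ f) {x₀ : X} {C : ℝ}
    (hC : ∀ᶠ x in 𝓝 x₀, f x ≤ C) : Continuous f :=
  have hbdd : ∃ x₀ ∈ Set.univ, (𝓝 x₀).IsBoundedUnder (· ≤ ·) f := ⟨x₀, Set.mem_univ x₀, C, hC⟩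
  continuousOn_univ.1 <|
    ((hf.continuousOn_tfae isOpen_univ Set.univ_nonempty).out 3 1).1 hbdd

theorem exists_affine_le_of_lt (hf : ConvexOn ℝ Set.univ f) (hlsc : LowerSemicontinuous f)
    {x : X} {a : ℝ} (ha : a < f x) :
    ∃ (ξ : StrongDual ℝ X) (c : ℝ), (∀ y, ξ y + c ≤ f y) ∧ ξ x + c = a := by
  obtain ⟨ξ, c, hle, heq⟩ := hf.exists_affine_le_of_lt (𝕜 := ℝ) (Set.mem_univ x) ha isClosed_univ
    (lowerSemicontinuousOn_univ_iff.2 hlsc)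
  exact ⟨ξ, c, fun y => by simpa using hle ⟨y, Set.mem_univ y⟩, by simpa using heq⟩

end ConvexFunctions

section WeakTopology

theorem isClosed_image_toWeakSpace {E : Type*} [AddCommGroup E] [Module ℝ E] [TopologicalSpace E]
    [IsTopologicalAddGroup E] [ContinuousSMul ℝ E] [LocallyConvexSpace ℝ E] {s : Set E}
    (hs : Convex ℝ s) (hs' : IsClosed s) : IsClosed (toWeakSpace ℝ E '' s) := by
  rw [← closure_eq_iff_isClosed, ← hs.toWeakSpace_closure ℝ, hs'.closure_eq]

theorem lowerSemicontinuous_comp_toWeakSpace_symm {E β : Type*} [AddCommGroup E] [Module ℝ E]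
    [TopologicalSpace E] [IsTopologicalAddGroup E] [ContinuousSMul ℝ E] [LocallyConvexSpace ℝ E]
    [LinearOrder β] {f : E → β} (hf : QuasiconvexOn ℝ Set.univ f) (hlsc : LowerSemicontinuous f) :
    LowerSemicontinuous (f ∘ (toWeakSpace ℝ E).symm) := by
  refine lowerSemicontinuous_iff_isClosed_preimage.2 fun b => ?_
  have hconv : Convex ℝ (f ⁻¹' Set.Iic b) := by simpa [Set.preimage, Set.mem_Iic] using hf b
  have := isClosed_image_toWeakSpace hconv (hlsc.isClosed_preimage b)
  rwa [LinearEquiv.image_eq_preimage_symm] at this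

variable {X : Type*} [NormedAddCommGroup X] [NormedSpace ℝ X]

theorem IsReflexive.isCompact_image_toWeakSpace (hX : IsReflexive X) {s : Set X}
    (hconv : Convex ℝ s) (hclosed : IsClosed s) (hbdd : Bornology.IsBounded s) :
    IsCompact (toWeakSpace ℝ X '' s) := by
  rw [← (isClosed_image_toWeakSpace hconv hclosed).closure_eq]
  refine NormedSpace.isCompact_closure_of_isBounded ℝ X _ ?_ ?_
  · rwa [Set.preimage_image_eq _ (toWeakSpace ℝ X).injective]
  · have hsurj : Function.Surjective (NormedSpace.inclusionInDoubleDualWeak ℝ X) := hX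
    simp only [hsurj.range_eq, Set.subset_univ]

theorem IsReflexive.exists_forall_le (hX : IsReflexive X) {β : Type*} [LinearOrder β] {f : X → β}
    (hf : QuasiconvexOn ℝ Set.univ f) (hlsc : LowerSemicontinuous f)
    (hcoercive : Tendsto f (Bornology.cobounded X) atTop) : ∃ x, ∀ y, f x ≤ f y := by
  obtain ⟨r, -, hr⟩ := (Metric.hasBasis_cobounded_compl_closedBall (0 : X)).eventually_iff.1
    (hcoercive.eventually_ge_atTop (f 0))
  have hmem : (0 : X) ∈ Metric.closedBall 0 |r| := by simp
  have hcompact := hX.isCompact_image_toWeakSpace (convex_closedBall (0 : X) |r|)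
    Metric.isClosed_closedBall Metric.isBounded_closedBall
  obtain ⟨_, ⟨x, -, rfl⟩, hx⟩ := LowerSemicontinuousOn.exists_isMinOn
    (Set.Nonempty.image _ ⟨0, hmem⟩) hcompact
    ((lowerSemicontinuous_comp_toWeakSpace_symm hf hlsc).lowerSemicontinuousOn _)
  have hball (y : X) (hy : y ∈ Metric.closedBall 0 |r|) : f x ≤ f y := by
    simpa using hx (Set.mem_image_of_mem _ hy)
  refine ⟨x, fun y => ?_⟩
  by_cases hy : y ∈ Metric.closedBall 0 |r|
  · exact hball y hy
  · have hyr : y ∉ Metric.closedBall 0 r :=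
      fun h => hy (Metric.closedBall_subset_closedBall (le_abs_self r) h)
    exact (hball 0 hmem).trans (hr hyr)

end WeakTopology

section Superlinear

/-- `f` grows superlinearly in the size function `N` (typically a norm): it dominates every multiple
of `N` up to an additive constant. Unlike `f x / N x → ∞`, this makes sense where `N x = 0` and
passes to disjoint unions. -/
def IsSuperlinear {α : Type*} (N f : α → ℝ) : Prop :=
  ∀ M, ∃ C, ∀ x, M * N x - C ≤ f x

theorem IsSuperlinear.sumElim {α β : Type*} {N f : α → ℝ} {N' f' : β → ℝ}
    (h : IsSuperlinear N f) (h' : IsSuperlinear N' f') :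
    IsSuperlinear (Sum.elim N N') (Sum.elim f f') := by
  intro M
  obtain ⟨C, hC⟩ := h M
  obtain ⟨C', hC'⟩ := h' M
  refine ⟨max C C', Sum.forall.2 ⟨fun x => ?_, fun y => ?_⟩⟩
  · exact (sub_le_sub_left (le_max_left C C') _).trans (hC x)
  · exact (sub_le_sub_left (le_max_right C C') _).trans (hC' y)

variable {X : Type*} [SeminormedAddCommGroup X] {f : X → ℝ}

theorem isSuperlinear_norm_of_tendsto_div (hbdd : BddBelow (Set.range f))
    (hf : Tendsto (fun v => f v / ‖v‖) (Bornology.cobounded X) atTop) :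
    IsSuperlinear norm f := by
  intro M
  obtain ⟨m, hm⟩ := hbdd
  obtain ⟨r, -, hr⟩ := hasBasis_cobounded_norm.eventually_iff.1 (hf.eventually_ge_atTop M)
  refine ⟨max 0 (|M| * |r| - m), fun v => ?_⟩
  rcases le_or_gt ‖v‖ |r| with hv | hv
  · have hmv : m ≤ f v := hm (Set.mem_range_self v)
    have hMv : M * ‖v‖ ≤ |M| * |r| := by gcongr; exact le_abs_self M
    linarith [le_max_right 0 (|M| * |r| - m)]
  · have hMv := hr ((le_abs_self r).trans hv.le)
    rw [le_div_iff₀ ((abs_nonneg r).trans_lt hv)] at hMv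
    linarith [le_max_left 0 (|M| * |r| - m)]

theorem IsSuperlinear.tendsto_atTop (hf : IsSuperlinear norm f) :
    Tendsto f (Bornology.cobounded X) atTop := by
  obtain ⟨C, hC⟩ := hf 1
  refine tendsto_atTop_mono (fun v => ?_)
    (tendsto_atTop_add_const_right _ (-C) tendsto_norm_cobounded_atTop)
  linarith [hC v]

end Superlinear

section AffineEnvelope

/-- The supremum of the positive parts of the affine functions `r ↦ n r - c n`. It is used when
`n ^ 2 ≤ c n`, which makes it finite; otherwise the real supremum may take its default value `0`. -/
noncomputable def affineEnvelope (c : ℕ → ℝ) (r : ℝ) : ℝ :=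
  ⨆ n : ℕ, max 0 (n * r - c n)

variable {c : ℕ → ℝ}

theorem affineEnvelope_nonneg (c : ℕ → ℝ) (r : ℝ) : 0 ≤ affineEnvelope c r :=
  Real.iSup_nonneg fun _ => le_max_left _ _

theorem affineEnvelope_le {r b : ℝ} (hb : 0 ≤ b) (h : ∀ n : ℕ, n * r - c n ≤ b) :
    affineEnvelope c r ≤ b :=
  ciSup_le fun n => max_le hb (h n)

theorem bddAbove_affineEnvelope (hc : ∀ n : ℕ, (n : ℝ) ^ 2 ≤ c n) (r : ℝ) :
    BddAbove (Set.range fun n : ℕ => max 0 (n * r - c n)) := by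
  refine ⟨r ^ 2, Set.forall_mem_range.2 fun n => max_le (sq_nonneg r) ?_⟩
  nlinarith [hc n, sq_nonneg ((n : ℝ) - r), sq_nonneg (n : ℝ), sq_nonneg r]

theorem le_affineEnvelope (hc : ∀ n : ℕ, (n : ℝ) ^ 2 ≤ c n) (n : ℕ) (r : ℝ) :
    n * r - c n ≤ affineEnvelope c r :=
  (le_max_right _ _).trans (le_ciSup (bddAbove_affineEnvelope hc r) n)

theorem monotone_affineEnvelope (hc : ∀ n : ℕ, (n : ℝ) ^ 2 ≤ c n) :
    Monotone (affineEnvelope c) := by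
  refine fun r s hrs => ciSup_mono (bddAbove_affineEnvelope hc s) fun n => ?_
  gcongr

theorem convexOn_affineEnvelope (hc : ∀ n : ℕ, (n : ℝ) ^ 2 ≤ c n) :
    ConvexOn ℝ Set.univ (affineEnvelope c) := by
  refine convexOn_ciSup convex_univ (fun n => ?_) fun r _ => bddAbove_affineEnvelope hc r
  have hlin : ConvexOn ℝ Set.univ fun r : ℝ => n * r :=
    (LinearMap.mulLeft ℝ (n : ℝ)).convexOn convex_univ
  exact (convexOn_const 0 convex_univ).sup (hlin.sub (concaveOn_const (c n) convex_univ))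

theorem tendsto_affineEnvelope_div (hc : ∀ n : ℕ, (n : ℝ) ^ 2 ≤ c n) :
    Tendsto (fun r => affineEnvelope c r / r) atTop atTop := by
  refine tendsto_atTop.2 fun b => ?_
  obtain ⟨n, hn⟩ := exists_nat_ge (b + 1)
  filter_upwards [eventually_ge_atTop (max 1 (c n))] with r hr
  obtain ⟨hr₁, hrc⟩ := max_le_iff.1 hr
  rw [le_div_iff₀ (by linarith)]
  have hbn : (b + 1) * r ≤ n * r := by gcongr
  linarith [le_affineEnvelope hc n r]

theorem IsSuperlinear.exists_convex_minorant {α : Type*} {N f : α → ℝ} (h : IsSuperlinear N f)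
    (hf : ∀ x, 0 ≤ f x) :
    ∃ Ψ : ℝ → ℝ, (∀ r, 0 ≤ Ψ r) ∧ ConvexOn ℝ Set.univ Ψ ∧ Monotone Ψ ∧
      Tendsto (fun r => Ψ r / r) atTop atTop ∧ ∀ x, Ψ (N x) ≤ f x := by
  choose C hC using fun n : ℕ => h n
  have hc (n : ℕ) : (n : ℝ) ^ 2 ≤ max (C n) (n ^ 2) := le_max_right _ _
  refine ⟨affineEnvelope fun n => max (C n) (n ^ 2), affineEnvelope_nonneg _,
    convexOn_affineEnvelope hc, monotone_affineEnvelope hc, tendsto_affineEnvelope_div hc,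
    fun x => affineEnvelope_le (hf x) fun n => ?_⟩
  exact (sub_le_sub_left (le_max_left _ _) _).trans (hC n x)

end AffineEnvelope

section Conjugate

theorem infConv_le {X : Type*} [Add X] (F G : X → EReal) (v₁ v₂ : X) :
    infConv F G (v₁ + v₂) ≤ F v₁ + G v₂ :=
  iInf₂_le (f := fun (p : X × X) (_ : p.1 + p.2 = v₁ + v₂) => F p.1 + G p.2) (v₁, v₂) rfl

theorem coe_sub_le_comm {a : ℝ} {x y : EReal} : (a : EReal) - x ≤ y ↔ (a : EReal) - y ≤ x := by
  induction x <;> induction y <;> simp [← EReal.coe_sub, add_comm]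

theorem coe_sub_add_coe_sub_le (a b : ℝ) (x y : EReal) :
    ((a : EReal) - x) + ((b : EReal) - y) ≤ ((a + b : ℝ) : EReal) - (x + y) := by
  induction x <;> induction y <;>
    simp [← EReal.coe_sub, ← EReal.coe_add, add_sub_add_comm]

variable {X : Type*} [NormedAddCommGroup X] [NormedSpace ℝ X]

theorem conjugate_le_iff {F : X → EReal} {ξ : StrongDual ℝ X} {b : EReal} :
    conjugate F ξ ≤ b ↔ ∀ v, ((ξ v : ℝ) : EReal) - b ≤ F v := by
  simp only [conjugate, iSup_le_iff, coe_sub_le_comm]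

theorem coe_sub_conjugate_le (F : X → EReal) (ξ : StrongDual ℝ X) (v : X) :
    ((ξ v : ℝ) : EReal) - conjugate F ξ ≤ F v :=
  conjugate_le_iff.1 le_rfl v

theorem conjugate_nonneg {F : X → EReal} (hF : F 0 ≤ 0) (ξ : StrongDual ℝ X) :
    0 ≤ conjugate F ξ := by
  have h := (coe_sub_conjugate_le F ξ 0).trans hF
  simpa [coe_sub_le_comm] using h

theorem conjugate_ne_bot {F : X → EReal} (hF : ∃ v, F v ≠ ⊤) (ξ : StrongDual ℝ X) :
    conjugate F ξ ≠ ⊥ := by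
  obtain ⟨v, hv⟩ := hF
  intro h
  have htop := coe_sub_conjugate_le F ξ v
  rw [h, EReal.coe_sub_bot, top_le_iff] at htop
  exact hv htop

theorem IsSuperlinear.conjugate_lt_top {f : X → ℝ} (hf : IsSuperlinear norm f)
    (ξ : StrongDual ℝ X) : conjugate (fun v => (f v : EReal)) ξ < ⊤ := by
  obtain ⟨C, hC⟩ := hf ‖ξ‖
  refine lt_of_le_of_lt (conjugate_le_iff.2 fun v => ?_) (EReal.coe_lt_top C)
  rw [← EReal.coe_sub, EReal.coe_le_coe_iff]
  linarith [hC v, (le_abs_self (ξ v)).trans (ξ.le_opNorm v)]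

theorem conjugate_infConv {F G : X → EReal} (hF : ∃ v, F v ≠ ⊤) (hG : ∃ v, G v ≠ ⊤)
    (ξ : StrongDual ℝ X) :
    conjugate (infConv F G) ξ = conjugate F ξ + conjugate G ξ := by
  have hF' := conjugate_ne_bot hF ξ
  have hG' := conjugate_ne_bot hG ξ
  refine le_antisymm (conjugate_le_iff.2 fun v => le_iInf₂ ?_)
    (EReal.add_le_of_forall_lt fun a ha b hb => ?_)
  · rintro ⟨v₁, v₂⟩ rfl
    calc ((ξ (v₁ + v₂) : ℝ) : EReal) - (conjugate F ξ + conjugate G ξ)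
        = ((ξ v₁ : ℝ) - conjugate F ξ) + ((ξ v₂ : ℝ) - conjugate G ξ) := by
          rw [map_add, EReal.coe_add, sub_eq_add_neg, EReal.neg_add (.inl hF') (.inr hG'),
            sub_eq_add_neg, add_add_add_comm, ← sub_eq_add_neg, ← sub_eq_add_neg]
      _ ≤ F v₁ + G v₂ := add_le_add (coe_sub_conjugate_le F ξ v₁) (coe_sub_conjugate_le G ξ v₂)
  · obtain ⟨v₁, hv₁⟩ := lt_iSup_iff.1 ha
    obtain ⟨v₂, hv₂⟩ := lt_iSup_iff.1 hb
    calc a + b ≤ ((ξ v₁ : ℝ) - F v₁) + ((ξ v₂ : ℝ) - G v₂) := add_le_add hv₁.le hv₂.le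
      _ ≤ ((ξ (v₁ + v₂) : ℝ) : EReal) - (F v₁ + G v₂) := by
        rw [map_add]
        exact coe_sub_add_coe_sub_le _ _ _ _
      _ ≤ ((ξ (v₁ + v₂) : ℝ) : EReal) - infConv F G (v₁ + v₂) :=
        EReal.sub_le_sub le_rfl (infConv_le F G v₁ v₂)
      _ ≤ conjugate (infConv F G) ξ := le_iSup (fun v => ((ξ v : ℝ) : EReal) - infConv F G v) _

/-- The Fenchel–Moreau theorem for real-valued functions. -/
theorem iSup_sub_conjugate {f : X → ℝ} (hf : ConvexOn ℝ Set.univ f) (hlsc : LowerSemicontinuous f)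
    (v : X) :
    ⨆ ξ : StrongDual ℝ X, ((ξ v : ℝ) : EReal) - conjugate (fun v => (f v : EReal)) ξ = f v := by
  refine le_antisymm (iSup_le fun ξ => coe_sub_conjugate_le _ ξ v)
    (EReal.ge_of_forall_gt_iff_ge.1 fun a ha => ?_)
  obtain ⟨ξ, c, hle, rfl⟩ := exists_affine_le_of_lt hf hlsc (EReal.coe_lt_coe_iff.1 ha)
  have hξ : conjugate (fun v => (f v : EReal)) ξ ≤ ((-c : ℝ) : EReal) :=
    conjugate_le_iff.2 fun y => by
      rw [← EReal.coe_sub, EReal.coe_le_coe_iff, sub_neg_eq_add]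
      exact hle y
  refine le_iSup_of_le ξ (le_trans ?_ (EReal.sub_le_sub le_rfl hξ))
  rw [← EReal.coe_sub, sub_neg_eq_add]

theorem le_halfLineConjugate {f : X → ℝ} (hf : ConvexOn ℝ Set.univ f)
    (hlsc : LowerSemicontinuous f) {Ψ : ℝ → ℝ}
    (hΨ : ∀ ξ : StrongDual ℝ X, (Ψ ‖ξ‖ : EReal) ≤ conjugate (fun v => (f v : EReal)) ξ) (v : X) :
    (f v : EReal) ≤ halfLineConjugate Ψ ‖v‖ := by
  rw [← iSup_sub_conjugate hf hlsc v]
  refine iSup_le fun ξ => ?_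
  calc ((ξ v : ℝ) : EReal) - conjugate (fun v => (f v : EReal)) ξ
      ≤ ((‖ξ‖ * ‖v‖ : ℝ) : EReal) - (Ψ ‖ξ‖ : EReal) :=
        EReal.sub_le_sub (EReal.coe_le_coe ((le_abs_self _).trans (ξ.le_opNorm v))) (hΨ ξ)
    _ ≤ halfLineConjugate Ψ ‖v‖ :=
        le_iSup (fun r : Set.Ici (0 : ℝ) => (((r : ℝ) * ‖v‖ - Ψ r : ℝ) : EReal))
          ⟨‖ξ‖, norm_nonneg ξ⟩

theorem continuous_of_norm_sub_le_conjugate {f : X → ℝ} (hf : ConvexOn ℝ Set.univ f)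
    (hlsc : LowerSemicontinuous f) {C : ℝ}
    (hC : ∀ ξ : StrongDual ℝ X, ((‖ξ‖ - C : ℝ) : EReal) ≤ conjugate (fun v => (f v : EReal)) ξ) :
    Continuous f := by
  refine continuous_of_convexOn_of_eventually_le hf (x₀ := 0) (C := C) ?_
  filter_upwards [Metric.closedBall_mem_nhds (0 : X) one_pos] with v hv
  rw [mem_closedBall_zero_iff] at hv
  refine EReal.coe_le_coe_iff.1 <|
    (le_halfLineConjugate hf hlsc (Ψ := (· - C)) hC v).trans (iSup_le fun r => ?_)
  rw [EReal.coe_le_coe_iff]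
  linarith [mul_le_of_le_one_right r.2 hv]

end Conjugate

namespace IsDissipationPotential

variable {X : Type*} [NormedAddCommGroup X] [NormedSpace ℝ X] {R : X → ℝ}

theorem isSuperlinear (hR : IsDissipationPotential R) : IsSuperlinear norm R :=
  isSuperlinear_norm_of_tendsto_div ⟨0, Set.forall_mem_range.2 hR.nonneg⟩ hR.superlinear

theorem conjugate_nonneg (hR : IsDissipationPotential R) (ξ : StrongDual ℝ X) :
    0 ≤ conjugate (fun v => (R v : EReal)) ξ :=
  InfConvolution.conjugate_nonneg (by simp [hR.zero]) ξ

theorem coe_toReal_conjugate (hR : IsDissipationPotential R) (ξ : StrongDual ℝ X) :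
    ((conjugate (fun v => (R v : EReal)) ξ).toReal : EReal) =
      conjugate (fun v => (R v : EReal)) ξ :=
  EReal.coe_toReal (hR.isSuperlinear.conjugate_lt_top ξ).ne
    (ne_bot_of_le_ne_bot EReal.zero_ne_bot (hR.conjugate_nonneg ξ))

theorem isSuperlinear_conjugate (hR : IsDissipationPotential R) :
    IsSuperlinear norm fun ξ : StrongDual ℝ X => (conjugate (fun v => (R v : EReal)) ξ).toReal := by
  refine isSuperlinear_norm_of_tendsto_div
    ⟨0, Set.forall_mem_range.2 fun ξ => EReal.toReal_nonneg (hR.conjugate_nonneg ξ)⟩ ?_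
  rw [← EReal.tendsto_coe_nhds_top_iff]
  simpa only [EReal.coe_div, hR.coe_toReal_conjugate] using hR.conjugate_superlinear

theorem continuous (hR : IsDissipationPotential R) : Continuous R := by
  obtain ⟨C, hC⟩ := hR.isSuperlinear_conjugate 1
  refine continuous_of_norm_sub_le_conjugate hR.convex hR.lsc (C := C) fun ξ => ?_
  rw [← hR.coe_toReal_conjugate, EReal.coe_le_coe_iff, ← one_mul ‖ξ‖]
  exact hC ξ

end IsDissipationPotential

section ExtendByTop

variable {X₁ X₂ : Type*} {ι : X₂ → X₁}

theorem extendByTop_apply (hι : Function.Injective ι) (R₂ : X₂ → ℝ) (w : X₂) :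
    extendByTop ι R₂ (ι w) = R₂ w :=
  hι.extend_apply _ _ w

theorem extendByTop_of_notMem_range (R₂ : X₂ → ℝ) {v : X₁} (hv : v ∉ Set.range ι) :
    extendByTop ι R₂ v = ⊤ :=
  Function.extend_apply' _ _ _ hv

theorem forall_le_extendByTop_iff (hι : Function.Injective ι) {R₂ : X₂ → ℝ} {F : X₁ → EReal} :
    (∀ v, F v ≤ extendByTop ι R₂ v) ↔ ∀ w, F (ι w) ≤ R₂ w := by
  refine ⟨fun h w => (h (ι w)).trans_eq (extendByTop_apply hι R₂ w), fun h v => ?_⟩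
  by_cases hv : v ∈ Set.range ι
  · obtain ⟨w, rfl⟩ := hv
    exact (h w).trans_eq (extendByTop_apply hι R₂ w).symm
  · exact le_top.trans_eq (extendByTop_of_notMem_range R₂ hv).symm

theorem conjugate_extendByTop [NormedAddCommGroup X₁] [NormedSpace ℝ X₁] [NormedAddCommGroup X₂]
    [NormedSpace ℝ X₂] {ι : X₂ →L[ℝ] X₁} (hι : Function.Injective ι) (R₂ : X₂ → ℝ)
    (ξ : StrongDual ℝ X₁) :
    conjugate (extendByTop ι R₂) ξ = conjugate (fun w => (R₂ w : EReal)) (ξ.comp ι) :=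
  eq_of_forall_ge_iff fun b => by
    rw [conjugate_le_iff, conjugate_le_iff, forall_le_extendByTop_iff hι]
    rfl

end ExtendByTop

section EffectivePotential

theorem effectivePotential_eq_iInf {X₁ X₂ : Type*} [AddGroup X₁] {ι : X₂ → X₁}
    (hι : Function.Injective ι) (R₁ : X₁ → ℝ) (R₂ : X₂ → ℝ) (v : X₁) :
    effectivePotential ι R₁ R₂ v = ⨅ w, ((R₁ (v - ι w) + R₂ w : ℝ) : EReal) := by
  refine le_antisymm (le_iInf fun w => ?_) (le_iInf₂ ?_)
  · have h := infConv_le (fun v => (R₁ v : EReal)) (extendByTop ι R₂) (v - ι w) (ι w)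
    rwa [sub_add_cancel, extendByTop_apply hι, ← EReal.coe_add] at h
  · rintro ⟨v₁, v₂⟩ rfl
    by_cases hv₂ : v₂ ∈ Set.range ι
    · obtain ⟨w, rfl⟩ := hv₂
      refine iInf_le_of_le w ?_
      rw [add_sub_cancel_right, extendByTop_apply hι, EReal.coe_add]
    · rw [extendByTop_of_notMem_range R₂ hv₂, EReal.coe_add_top]
      exact le_top

theorem effectivePotential_eq_coe_ciInf {X₁ X₂ : Type*} [AddGroup X₁] [Nonempty X₂]
    {ι : X₂ → X₁} (hι : Function.Injective ι) {R₁ : X₁ → ℝ} {R₂ : X₂ → ℝ} {v : X₁}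
    (hbdd : BddBelow (Set.range fun w => R₁ (v - ι w) + R₂ w)) :
    effectivePotential ι R₁ R₂ v = ((⨅ w, (R₁ (v - ι w) + R₂ w) : ℝ) : EReal) := by
  rw [effectivePotential_eq_iInf hι, EReal.coe_strictMono.monotone.map_ciInf_of_continuousAt
    continuous_coe_real_ereal.continuousAt hbdd]

theorem effectivePotential_le {X₁ X₂ : Type*} [AddGroup X₁] {ι : X₂ → X₁}
    (hι : Function.Injective ι) (R₁ : X₁ → ℝ) (R₂ : X₂ → ℝ) (v : X₁) (w : X₂) :
    effectivePotential ι R₁ R₂ v ≤ ((R₁ (v - ι w) + R₂ w : ℝ) : EReal) :=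
  (effectivePotential_eq_iInf hι R₁ R₂ v).trans_le (iInf_le _ w)

theorem effectivePotential_nonneg {X₁ X₂ : Type*} [AddGroup X₁] {ι : X₂ → X₁}
    (hι : Function.Injective ι) {R₁ : X₁ → ℝ} {R₂ : X₂ → ℝ} (h₁ : ∀ v, 0 ≤ R₁ v)
    (h₂ : ∀ w, 0 ≤ R₂ w) (v : X₁) : 0 ≤ effectivePotential ι R₁ R₂ v := by
  rw [effectivePotential_eq_iInf hι]
  exact le_iInf fun w => EReal.coe_nonneg.2 (add_nonneg (h₁ _) (h₂ w))

theorem bddBelow_range_sub_add {X₁ X₂ : Type*} [Sub X₁] {R₁ : X₁ → ℝ} {R₂ : X₂ → ℝ}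
    (h₁ : BddBelow (Set.range R₁)) (h₂ : BddBelow (Set.range R₂)) (ι : X₂ → X₁) (v : X₁) :
    BddBelow (Set.range fun w => R₁ (v - ι w) + R₂ w) := by
  obtain ⟨m₁, hm₁⟩ := h₁
  obtain ⟨m₂, hm₂⟩ := h₂
  exact ⟨m₁ + m₂, Set.forall_mem_range.2 fun w =>
    add_le_add (hm₁ (Set.mem_range_self _)) (hm₂ (Set.mem_range_self w))⟩

section Convexity

variable {X₁ X₂ : Type*} [AddCommGroup X₁] [Module ℝ X₁] [AddCommGroup X₂] [Module ℝ X₂]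
  {R₁ : X₁ → ℝ} {R₂ : X₂ → ℝ}

theorem convexOn_sub_add (h₁ : ConvexOn ℝ Set.univ R₁) (h₂ : ConvexOn ℝ Set.univ R₂)
    (ι : X₂ →ₗ[ℝ] X₁) :
    ConvexOn ℝ Set.univ fun p : X₁ × X₂ => R₁ (p.1 - ι p.2) + R₂ p.2 :=
  (h₁.comp_linearMap (LinearMap.fst ℝ X₁ X₂ - ι ∘ₗ LinearMap.snd ℝ X₁ X₂)).add
    (h₂.comp_linearMap (LinearMap.snd ℝ X₁ X₂))

theorem convexOn_toReal_effectivePotential {ι : X₂ →ₗ[ℝ] X₁} (hι : Function.Injective ι)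
    (h₁ : ConvexOn ℝ Set.univ R₁) (h₂ : ConvexOn ℝ Set.univ R₂)
    (hbdd₁ : BddBelow (Set.range R₁)) (hbdd₂ : BddBelow (Set.range R₂)) :
    ConvexOn ℝ Set.univ fun v => (effectivePotential ι R₁ R₂ v).toReal := by
  have hbdd := bddBelow_range_sub_add hbdd₁ hbdd₂ ι
  simpa only [effectivePotential_eq_coe_ciInf hι (hbdd _), EReal.toReal_coe] using
    convexOn_ciInf_snd (convexOn_sub_add h₁ h₂ ι) hbdd

end Convexity

variable {X₁ X₂ : Type*} [NormedAddCommGroup X₁] [NormedSpace ℝ X₁]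
  [NormedAddCommGroup X₂] [NormedSpace ℝ X₂] {ι : X₂ →L[ℝ] X₁} {R₁ : X₁ → ℝ} {R₂ : X₂ → ℝ}

theorem continuous_effectivePotential (hι : Function.Injective ι)
    (h₁ : ConvexOn ℝ Set.univ R₁) (h₂ : ConvexOn ℝ Set.univ R₂)
    (hbdd₁ : BddBelow (Set.range R₁)) (hbdd₂ : BddBelow (Set.range R₂)) (hcont : Continuous R₁) :
    Continuous (effectivePotential ι R₁ R₂) := by
  have hbdd := bddBelow_range_sub_add hbdd₁ hbdd₂ ι
  have heq : effectivePotential ι R₁ R₂ = fun v => ((⨅ w, (R₁ (v - ι w) + R₂ w) : ℝ) : EReal) :=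
    funext fun v => effectivePotential_eq_coe_ciInf hι (hbdd v)
  have hconv := convexOn_toReal_effectivePotential (ι := ι.toLinearMap) hι h₁ h₂ hbdd₁ hbdd₂
  have hle (v : X₁) : ⨅ w, (R₁ (v - ι w) + R₂ w) ≤ R₁ v + R₂ 0 := by
    simpa using ciInf_le (hbdd v) 0
  simp only [ContinuousLinearMap.coe_coe, heq, EReal.toReal_coe] at hconv
  rw [heq]
  refine continuous_coe_real_ereal.comp
    (continuous_of_convexOn_of_eventually_le hconv (x₀ := 0) (C := R₁ 0 + 1 + R₂ 0) ?_)
  filter_upwards [hcont.continuousAt.eventually_le_const (lt_add_one (R₁ 0))] with v hv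
  exact (hle v).trans (by gcongr)

theorem IsReflexive.exists_effectivePotential_eq (hX₂ : IsReflexive X₂)
    (hι : Function.Injective ι) (h₁ : ConvexOn ℝ Set.univ R₁) (h₂ : ConvexOn ℝ Set.univ R₂)
    (hlsc₁ : LowerSemicontinuous R₁) (hlsc₂ : LowerSemicontinuous R₂)
    (hbdd₁ : BddBelow (Set.range R₁)) (hsuper₂ : IsSuperlinear norm R₂) (v : X₁) :
    ∃ w, effectivePotential ι R₁ R₂ v = (R₁ (v - ι w) : EReal) + extendByTop ι R₂ (ι w) := by
  have hconv : ConvexOn ℝ Set.univ fun w => R₁ (v - ι w) + R₂ w :=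
    (convexOn_sub_add h₁ h₂ ι.toLinearMap).comp_affineMap
      ((AffineMap.const ℝ X₂ v).prod (AffineMap.id ℝ X₂))
  have hlsc : LowerSemicontinuous fun w => R₁ (v - ι w) + R₂ w :=
    (hlsc₁.comp (continuous_const.sub ι.continuous)).add hlsc₂
  have hcoercive : Tendsto (fun w => R₁ (v - ι w) + R₂ w) (Bornology.cobounded X₂) atTop := by
    obtain ⟨m, hm⟩ := hbdd₁
    exact tendsto_atTop_add_left_of_le _ m (fun w => hm (Set.mem_range_self _))
      hsuper₂.tendsto_atTop
  obtain ⟨w, hw⟩ := hX₂.exists_forall_le hconv.quasiconvexOn hlsc hcoercive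
  refine ⟨w, ?_⟩
  rw [extendByTop_apply hι, ← EReal.coe_add]
  refine le_antisymm (effectivePotential_le hι R₁ R₂ v w) ?_
  rw [effectivePotential_eq_iInf hι]
  exact le_iInf fun w' => EReal.coe_le_coe (hw w')

theorem conjugate_effectivePotential (hι : Function.Injective ι) (R₁ : X₁ → ℝ) (R₂ : X₂ → ℝ)
    (ξ : StrongDual ℝ X₁) :
    conjugate (effectivePotential ι R₁ R₂) ξ =
      conjugate (fun v => (R₁ v : EReal)) ξ +
        conjugate (fun w => (R₂ w : EReal)) (ξ.comp ι) := by
  have hproper : ∃ v, extendByTop ι R₂ v ≠ ⊤ :=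
    ⟨ι 0, by simp [extendByTop_apply hι, -map_zero]⟩
  rw [← conjugate_extendByTop hι]
  exact conjugate_infConv (F := fun v => (R₁ v : EReal)) ⟨0, EReal.coe_ne_top _⟩ hproper ξ

end EffectivePotential

section SuperlinearMinorant

theorem two_mul_half_le_add {Ψ : ℝ → ℝ} (hconv : ConvexOn ℝ (Set.Ici 0) Ψ) {r s : ℝ}
    (hr : 0 ≤ r) (hs : 0 ≤ s) : 2 * Ψ ((r + s) / 2) ≤ Ψ r + Ψ s := by
  have hhalf : (0 : ℝ) ≤ 1 / 2 := by norm_num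
  have h := hconv.2 hr hs hhalf hhalf (add_halves 1)
  rw [← smul_add, smul_eq_mul, one_div_mul_eq_div] at h
  simp only [smul_eq_mul] at h
  linarith

variable {X₁ X₂ : Type*} [NormedAddCommGroup X₁] [NormedAddCommGroup X₂]

theorem two_mul_le_effectivePotential {ι : X₂ → X₁} (hι : Function.Injective ι) {CN : ℝ}
    (hCN : 1 ≤ CN) (hnorm : ∀ w, ‖ι w‖ ≤ CN * ‖w‖) {R₁ : X₁ → ℝ} {R₂ : X₂ → ℝ} {Ψ : ℝ → ℝ}
    (hconv : ConvexOn ℝ (Set.Ici 0) Ψ) (hmono : MonotoneOn Ψ (Set.Ici 0))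
    (h₁ : ∀ v, Ψ ‖v‖ ≤ R₁ v) (h₂ : ∀ w, Ψ ‖w‖ ≤ R₂ w) (v : X₁) :
    ((2 * Ψ (1 / (2 * CN) * ‖v‖) : ℝ) : EReal) ≤ effectivePotential ι R₁ R₂ v := by
  rw [effectivePotential_eq_iInf hι]
  refine le_iInf fun w => EReal.coe_le_coe ?_
  have htriangle : ‖v‖ ≤ CN * (‖v - ι w‖ + ‖w‖) :=
    calc ‖v‖ ≤ ‖v - ι w‖ + ‖ι w‖ := norm_le_norm_sub_add v (ι w)
      _ ≤ CN * ‖v - ι w‖ + CN * ‖w‖ :=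
        add_le_add (le_mul_of_one_le_left (norm_nonneg _) hCN) (hnorm w)
      _ = CN * (‖v - ι w‖ + ‖w‖) := (mul_add _ _ _).symm
  have hhalf : 1 / (2 * CN) * ‖v‖ ≤ (‖v - ι w‖ + ‖w‖) / 2 := by
    rw [one_div_mul_eq_div, div_le_iff₀ (by positivity)]
    linarith
  calc 2 * Ψ (1 / (2 * CN) * ‖v‖) ≤ 2 * Ψ ((‖v - ι w‖ + ‖w‖) / 2) := by
        gcongr
        exact hmono (Set.mem_Ici.2 (by positivity)) (Set.mem_Ici.2 (by positivity)) hhalf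
    _ ≤ Ψ ‖v - ι w‖ + Ψ ‖w‖ := two_mul_half_le_add hconv (norm_nonneg _) (norm_nonneg w)
    _ ≤ R₁ (v - ι w) + R₂ w := add_le_add (h₁ _) (h₂ w)

theorem exists_isSuperlinearMinorant [NormedSpace ℝ X₁] [NormedSpace ℝ X₂] {R₁ : X₁ → ℝ}
    {R₂ : X₂ → ℝ} (hR₁ : IsDissipationPotential R₁) (hR₂ : IsDissipationPotential R₂) :
    ∃ Ψ : ℝ → ℝ, IsSuperlinearMinorant R₁ R₂ Ψ := by
  have hsuper := (hR₁.isSuperlinear.sumElim hR₂.isSuperlinear).sumElim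
    (hR₁.isSuperlinear_conjugate.sumElim hR₂.isSuperlinear_conjugate)
  obtain ⟨Ψ, hnonneg, hconv, hmono, htendsto, hle⟩ := hsuper.exists_convex_minorant <|
    Sum.forall.2 ⟨Sum.forall.2 ⟨hR₁.nonneg, hR₂.nonneg⟩,
      Sum.forall.2 ⟨fun ξ => EReal.toReal_nonneg (hR₁.conjugate_nonneg ξ),
        fun ξ => EReal.toReal_nonneg (hR₂.conjugate_nonneg ξ)⟩⟩
  refine ⟨Ψ, fun r _ => hnonneg r, hconv.subset (Set.subset_univ _) (convex_Ici 0),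
    hmono.monotoneOn _, htendsto, fun v => hle (.inl (.inl v)), fun w => hle (.inl (.inr w)),
    fun ξ => ?_, fun ξ => ?_⟩
  · rw [← hR₁.coe_toReal_conjugate, EReal.coe_le_coe_iff]
    exact hle (.inr (.inl ξ))
  · rw [← hR₂.coe_toReal_conjugate, EReal.coe_le_coe_iff]
    exact hle (.inr (.inr ξ))

end SuperlinearMinorant

end InfConvolution

open InfConvolution in
theorem mainTheorem7_general {X₁ X₂ : Type*}
    [NormedAddCommGroup X₁] [NormedSpace ℝ X₁] [NormedAddCommGroup X₂] [NormedSpace ℝ X₂]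
    (hX₂ : IsReflexive X₂) (ι : X₂ →L[ℝ] X₁) (hι : Function.Injective ι)
    (CN : ℝ) (hCN : 1 ≤ CN) (hnorm : ∀ w : X₂, ‖ι w‖ ≤ CN * ‖w‖)
    (R₁ : X₁ → ℝ) (R₂ : X₂ → ℝ)
    (hR₁ : IsDissipationPotential R₁) (hR₂ : IsDissipationPotential R₂) :
    (∀ v, 0 ≤ effectivePotential ι R₁ R₂ v ∧
      effectivePotential ι R₁ R₂ v < ⊤) ∧
    (∀ v, ∃ v₁ v₂ : X₁, v₁ + v₂ = v ∧
      effectivePotential ι R₁ R₂ v =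
        (R₁ v₁ : EReal) + extendByTop ι R₂ v₂) ∧
    LowerSemicontinuous (effectivePotential ι R₁ R₂) ∧
    ConvexOn ℝ Set.univ (fun v => (effectivePotential ι R₁ R₂ v).toReal) ∧
    (∀ ξ : StrongDual ℝ X₁,
      conjugate (effectivePotential ι R₁ R₂) ξ =
          conjugate (fun v => (R₁ v : EReal)) ξ +
            conjugate (fun w => (R₂ w : EReal)) (ξ.comp ι) ∧
        0 ≤ conjugate (effectivePotential ι R₁ R₂) ξ ∧
        conjugate (effectivePotential ι R₁ R₂) ξ < ⊤) ∧
    (∃ Ψ : ℝ → ℝ, IsSuperlinearMinorant R₁ R₂ Ψ) ∧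
    (∀ Ψ : ℝ → ℝ, IsSuperlinearMinorant R₁ R₂ Ψ → ∀ v : X₁,
      ((2 * Ψ (1 / (2 * CN) * ‖v‖) : ℝ) : EReal) ≤ effectivePotential ι R₁ R₂ v ∧
      effectivePotential ι R₁ R₂ v ≤ (R₁ v : EReal) ∧
      (R₁ v : EReal) ≤ halfLineConjugate Ψ ‖v‖) := by
  have hbdd₁ : BddBelow (Set.range R₁) := ⟨0, Set.forall_mem_range.2 hR₁.nonneg⟩
  have hbdd₂ : BddBelow (Set.range R₂) := ⟨0, Set.forall_mem_range.2 hR₂.nonneg⟩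
  have hle (v : X₁) : effectivePotential ι R₁ R₂ v ≤ R₁ v := by
    simpa [hR₂.zero] using effectivePotential_le hι R₁ R₂ v 0
  refine ⟨fun v => ⟨effectivePotential_nonneg hι hR₁.nonneg hR₂.nonneg v,
      (hle v).trans_lt (EReal.coe_lt_top _)⟩, fun v => ?_,
    (continuous_effectivePotential hι hR₁.convex hR₂.convex hbdd₁ hbdd₂
      hR₁.continuous).lowerSemicontinuous,
    convexOn_toReal_effectivePotential (ι := ι.toLinearMap) hι hR₁.convex hR₂.convex hbdd₁ hbdd₂,
    fun ξ => ?_, exists_isSuperlinearMinorant hR₁ hR₂, fun Ψ hΨ v => ⟨?_, hle v, ?_⟩⟩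
  · obtain ⟨w, hw⟩ := hX₂.exists_effectivePotential_eq hι hR₁.convex hR₂.convex hR₁.lsc hR₂.lsc
      hbdd₁ hR₂.isSuperlinear v
    exact ⟨v - ι w, ι w, sub_add_cancel v (ι w), hw⟩
  · rw [conjugate_effectivePotential hι]
    exact ⟨rfl, add_nonneg (hR₁.conjugate_nonneg ξ) (hR₂.conjugate_nonneg _),
      EReal.add_lt_top (hR₁.isSuperlinear.conjugate_lt_top ξ).ne
        (hR₂.isSuperlinear.conjugate_lt_top _).ne⟩
  · exact two_mul_le_effectivePotential hι hCN hnorm hΨ.convex hΨ.mono hΨ.le₁ hΨ.le₂ v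
  · exact le_halfLineConjugate hR₁.convex hR₁.lsc hΨ.le_conjugate₁ v

theorem mainTheorem7 {X₁ X₂ : Type*}
    [NormedAddCommGroup X₁] [NormedSpace ℝ X₁] [CompleteSpace X₁]
    [NormedAddCommGroup X₂] [NormedSpace ℝ X₂] [CompleteSpace X₂]
    (hX₁ : InfConvolution.IsReflexive X₁) (hX₂ : InfConvolution.IsReflexive X₂)
    -- the dense and continuous embedding of `X₂` into `X₁`
    (ι : X₂ →L[ℝ] X₁) (hι : Function.Injective ι) (hdense : DenseRange ι)
    (CN : ℝ) (hCN : 1 ≤ CN) (hnorm : ∀ w : X₂, ‖ι w‖ ≤ CN * ‖w‖)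
    (R₁ : X₁ → ℝ) (R₂ : X₂ → ℝ)
    (hR₁ : InfConvolution.IsDissipationPotential R₁)
    (hR₂ : InfConvolution.IsDissipationPotential R₂) :
    -- the effective potential takes values in `[0, ∞)`
    (∀ v, 0 ≤ InfConvolution.effectivePotential ι R₁ R₂ v ∧
      InfConvolution.effectivePotential ι R₁ R₂ v < ⊤) ∧
    -- the infimum is a minimum
    (∀ v, ∃ v₁ v₂ : X₁, v₁ + v₂ = v ∧
      InfConvolution.effectivePotential ι R₁ R₂ v =
        (R₁ v₁ : EReal) + InfConvolution.extendByTop ι R₂ v₂) ∧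
    -- lower semicontinuity and convexity
    LowerSemicontinuous (InfConvolution.effectivePotential ι R₁ R₂) ∧
    ConvexOn ℝ Set.univ (fun v => (InfConvolution.effectivePotential ι R₁ R₂ v).toReal) ∧
    -- the conjugate is finite and equals `R₁* + R₂*`, where `ξ ∈ X₁*` acts on `X₂` as `ξ ∘ ι`
    (∀ ξ : StrongDual ℝ X₁,
      InfConvolution.conjugate (InfConvolution.effectivePotential ι R₁ R₂) ξ =
          InfConvolution.conjugate (fun v => (R₁ v : EReal)) ξ +
            InfConvolution.conjugate (fun w => (R₂ w : EReal)) (ξ.comp ι) ∧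
        0 ≤ InfConvolution.conjugate (InfConvolution.effectivePotential ι R₁ R₂) ξ ∧
        InfConvolution.conjugate (InfConvolution.effectivePotential ι R₁ R₂) ξ < ⊤) ∧
    -- a superlinear minorant exists, and each of them gives the two-sided bounds
    (∃ Ψ : ℝ → ℝ, InfConvolution.IsSuperlinearMinorant R₁ R₂ Ψ) ∧
    (∀ Ψ : ℝ → ℝ, InfConvolution.IsSuperlinearMinorant R₁ R₂ Ψ → ∀ v : X₁,
      ((2 * Ψ (1 / (2 * CN) * ‖v‖) : ℝ) : EReal) ≤ InfConvolution.effectivePotential ι R₁ R₂ v ∧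
      InfConvolution.effectivePotential ι R₁ R₂ v ≤ (R₁ v : EReal) ∧
      (R₁ v : EReal) ≤ InfConvolution.halfLineConjugate Ψ ‖v‖) :=
  mainTheorem7_general hX₂ ι hι CN hCN hnorm R₁ R₂ hR₁ hR₂
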